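/- Let $d, n \ge 1$ be integers and let $\Lambda = A\mathbb{Z}^{2d} \subset \mathbb{R}^{2d}$ be a lattice, where $A$ is a non-singular real $2d\times 2d$ matrix; let $s(\Lambda) = |\det A|$ be the volume of a fundamental domain of $\Lambda$. For $z = (x,\xi) \in \mathbb{R}^d\times\mathbb{R}^d$ and $\mathbf{f} \in L^2(\mathbb{R}^d,\mathbb{C}^n)$ let $\pi_z \mathbf{f}(t) = e^{2\pi i \xi\cdot t}\,\mathbf{f}(t-x)$. Let $\mathbf{g} \in L^2(\mathbb{R}^d,\mathbb{C}^n)$. Suppose that the Gabor system $\mathcal{G}(\mathbf{g},\Lambda) = \{\pi_\lambda \mathbf{g} : \lambda\in\Lambda\}$ is a frame for $L^2(\mathbb{R}^d,\mathbb{C}^n)$, i.e. there are constants $a, b > 0$ such that $$a\,\|\mathbf{f}\|^2 \le \sum_{\lambda\in\Lambda} |\langle \mathbf{f}, \pi_\lambda \mathbf{g}\rangle|^2 \le b\,\|\mathbf{f}\|^2 \qquad \text{for all } \mathbf{f} \in L^2(\mathbb{R}^d,\mathbb{C}^n),$$ where $\langle \mathbf{f},\mathbf{h}\rangle = \sum_{j=1}^n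 \int_{\mathbb{R}^d} f_j(t)\overline{h_j(t)}\,dt$. Then $s(\Lambda) \le \frac1n$. -/

import Mathlib

open MeasureTheory

noncomputable section

/-- A family `e` in a complex Hilbert space `H` is a frame if there are constants `A, B > 0` with
`A ‖f‖² ≤ ∑ i, |⟨f, e i⟩|² ≤ B ‖f‖²` for all `f` (in particular, the series converges). -/
def IsFrame {ι H : Type*} [NormedAddCommGroup H] [InnerProductSpace ℂ H] (e : ι → H) : Prop :=
  ∃ A B : ℝ, 0 < A ∧ 0 < B ∧ ∀ f : H,
    Summable (fun i => ‖inner ℂ (e i) f‖ ^ 2) ∧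
    A * ‖f‖ ^ 2 ≤ ∑' i, ‖inner ℂ (e i) f‖ ^ 2 ∧
    ∑' i, ‖inner ℂ (e i) f‖ ^ 2 ≤ B * ‖f‖ ^ 2

/-- The Hilbert space `L²(ℝ^d, ℂ^n)`; its inner product is the sum over the coordinates of the
`L²` inner products. -/
abbrev L2Vec (d n : ℕ) : Type :=
  Lp (EuclideanSpace ℂ (Fin n)) 2 (volume : Measure (EuclideanSpace ℝ (Fin d)))

/-- The time-frequency shift on functions: `(π_(x,ξ) f)(t) = exp(2πi ξ·t) f(t - x)`. -/
def timeFreqShiftFun {d n : ℕ} (x ξ : EuclideanSpace ℝ (Fin d))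
    (f : EuclideanSpace ℝ (Fin d) → EuclideanSpace ℂ (Fin n)) :
    EuclideanSpace ℝ (Fin d) → EuclideanSpace ℂ (Fin n) :=
  fun t => Complex.exp (2 * Real.pi * Complex.I * (inner ℝ ξ t : ℝ)) • f (t - x)

theorem memLp_timeFreqShiftFun {d n : ℕ} (x ξ : EuclideanSpace ℝ (Fin d))
    {f : EuclideanSpace ℝ (Fin d) → EuclideanSpace ℂ (Fin n)} (hf : MemLp f 2 volume) :
    MemLp (timeFreqShiftFun x ξ f) 2 volume := by
  have h1 : MemLp (fun t => f (t - x)) 2 volume :=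
    hf.comp_measurePreserving (measurePreserving_sub_right volume x)
  refine h1.of_le ?_ (Filter.Eventually.of_forall fun t => ?_)
  · have hc : Continuous fun t : EuclideanSpace ℝ (Fin d) =>
        Complex.exp (2 * Real.pi * Complex.I * (inner ℝ ξ t : ℝ)) := by fun_prop
    exact hc.aestronglyMeasurable.smul h1.1
  · have h2 : (2 * Real.pi * Complex.I * (inner ℝ ξ t : ℝ) : ℂ)
        = ((2 * Real.pi * inner ℝ ξ t : ℝ) : ℂ) * Complex.I := by
      push_cast; ring
    rw [timeFreqShiftFun, h2, norm_smul, Complex.norm_exp_ofReal_mul_I, one_mul]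

/-- The time-frequency shift `π_z`, `z = (x, ξ) ∈ ℝ^d × ℝ^d = ℝ^{2d}`, on `L²(ℝ^d, ℂ^n)`.
The coordinates of `z` indexed by `Sum.inl` form `x`, those indexed by `Sum.inr` form `ξ`. -/
def timeFreqShift {d n : ℕ} (z : Fin d ⊕ Fin d → ℝ) (f : L2Vec d n) : L2Vec d n :=
  (memLp_timeFreqShiftFun (WithLp.toLp 2 fun i => z (Sum.inl i))
    (WithLp.toLp 2 fun i => z (Sum.inr i)) (Lp.memLp f)).toLp _

/-- The set `A ℤ^{2d} ⊆ ℝ^{2d}`, a lattice when `A` is non-singular. -/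
def latticeOf {d : ℕ} (A : Matrix (Fin d ⊕ Fin d) (Fin d ⊕ Fin d) ℝ) :
    Set (Fin d ⊕ Fin d → ℝ) :=
  Set.range fun k : Fin d ⊕ Fin d → ℤ => A.mulVec fun i => (k i : ℝ)

/-- The vector-valued Gabor system `{π_λ g : λ ∈ Λ}`, as a family indexed by `Λ`. -/
def gaborSystem {d n : ℕ} (g : L2Vec d n) (Λ : Set (Fin d ⊕ Fin d → ℝ)) : Λ → L2Vec d n :=
  fun l => timeFreqShift (l : Fin d ⊕ Fin d → ℝ) g

/-- The volume `s(Λ) = |det A|` of a fundamental domain of the lattice `Λ = A ℤ^{2d}`. -/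
def latticeVolume {d : ℕ} (A : Matrix (Fin d ⊕ Fin d) (Fin d ⊕ Fin d) ℝ) : ℝ :=
  |A.det|

end

/-! Let S be the frame operator of the Gabor system. It commutes with the shifts by lattice points,
so γ = S^(-1/2) g generates a Parseval Gabor frame over the same lattice (`exists_parseval_window`),
and this forces ‖γ‖ ≤ 1. Applying the Parseval identity to shifted copies of f and integrating over
a fundamental domain D gives ∫ |⟨π_z γ, f⟩|² dz = |D| ‖f‖²
(`lintegral_enorm_inner_timeFreqShift_sq_eq`). For f = 1_K e_j, with K a ball, Plancherel bounds the
left side by |K| ‖γ_j‖² (`lintegral_enorm_inner_timeFreqShift_sq_le`), so |D| ≤ ‖γ_j‖² for each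
coordinate j. Summing over j, n |D| ≤ ‖γ‖² ≤ 1. -/

noncomputable section

/-! ### Abstract frames and their Parseval normalization -/

section Frame

open scoped InnerProductSpace

variable {ι H : Type*} [NormedAddCommGroup H] [InnerProductSpace ℂ H]

/-- A system with the upper frame bound has a bounded analysis operator into `ℓ²`. -/
theorem exists_analysisOperator (e : ι → H) {B : ℝ} (hs : ∀ f, Summable fun i => ‖⟪e i, f⟫_ℂ‖ ^ 2)
    (hB : ∀ f, ∑' i, ‖⟪e i, f⟫_ℂ‖ ^ 2 ≤ B * ‖f‖ ^ 2) :
    ∃ C : H →L[ℂ] lp (fun _ : ι => ℂ) 2, ∀ f, ‖C f‖ ^ 2 = ∑' i, ‖⟪e i, f⟫_ℂ‖ ^ 2 := by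
  have hm : ∀ f, Memℓp (fun i => ⟪e i, f⟫_ℂ) 2 := fun f => by
    refine memℓp_gen ?_
    simpa using hs f
  let L : H →ₗ[ℂ] lp (fun _ : ι => ℂ) 2 :=
    { toFun := fun f => ⟨fun i => ⟪e i, f⟫_ℂ, hm f⟩
      map_add' := fun f g => by
        ext i
        exact inner_add_right _ _ _
      map_smul' := fun c f => by
        ext i
        exact inner_smul_right _ _ _ }
  have hL : ∀ f, ‖L f‖ ^ 2 = ∑' i, ‖⟪e i, f⟫_ℂ‖ ^ 2 := fun f => by
    have h := lp.norm_rpow_eq_tsum (p := 2) (by norm_num) (L f)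
    simpa [L] using h
  refine ⟨L.mkContinuous (Real.sqrt B) fun f => ?_, hL⟩
  -- The sign of `B` is not assumed; a negative `B` forces the operator to vanish.
  rcases le_or_gt 0 B with h0 | h0
  · refine (pow_le_pow_iff_left₀ (norm_nonneg _) (by positivity) two_ne_zero).1 ?_
    rw [mul_pow, Real.sq_sqrt h0, hL]
    exact hB f
  · have h1 : ‖L f‖ ^ 2 ≤ B * ‖f‖ ^ 2 := (hL f).trans_le (hB f)
    have h2 : ‖L f‖ = 0 := by
      have : B * ‖f‖ ^ 2 ≤ 0 := mul_nonpos_of_nonpos_of_nonneg h0.le (by positivity)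
      nlinarith [sq_nonneg ‖L f‖, norm_nonneg (L f)]
    rw [h2]
    positivity

variable [CompleteSpace H]

open ContinuousLinearMap in
/-- The inverse square root `R` of the frame operator turns a frame into a Parseval frame, and
commutes with every unitary operator that leaves the frame coefficients invariant. -/
theorem IsFrame.exists_parseval {e : ι → H} (he : IsFrame e) :
    ∃ R : H →L[ℂ] H, IsSelfAdjoint R ∧
      (∀ U : H ≃ₗᵢ[ℂ] H,
        (∀ f, ∑' i, ‖⟪e i, U f⟫_ℂ‖ ^ 2 = ∑' i, ‖⟪e i, f⟫_ℂ‖ ^ 2) → ∀ f, R (U f) = U (R f)) ∧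
      ∀ f, HasSum (fun i => ‖⟪e i, R f⟫_ℂ‖ ^ 2) (‖f‖ ^ 2) := by
  obtain ⟨a, b, ha, -, h⟩ := he
  obtain ⟨C, hC⟩ := exists_analysisOperator e (fun f => (h f).1) (fun f => (h f).2.2)
  set S : H →L[ℂ] H := adjoint C ∘L C with hS
  have hSf : ∀ f, ⟪S f, f⟫_ℂ = ((∑' i, ‖⟪e i, f⟫_ℂ‖ ^ 2 : ℝ) : ℂ) := fun f => by
    rw [hS, ← hC, comp_apply, adjoint_inner_left, inner_self_eq_norm_sq_to_K]
    norm_cast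
  have hpos : 0 ≤ S := (nonneg_iff_isPositive S).2 (isPositive_adjoint_comp_self C)
  have hunit : IsUnit S := by
    -- The lower frame bound makes S coercive, hence invertible, so negative powers make sense.
    refine isUnit_of_forall_le_norm_inner_map S (c := ⟨a, ha.le⟩) ha fun f => ?_
    rw [hSf, Complex.norm_real, mul_comm]
    exact (h f).2.1.trans (le_abs_self _)
  set R : H →L[ℂ] H := S ^ (-(1 / 2) : ℝ) with hR
  have hRsa : IsSelfAdjoint R := IsSelfAdjoint.of_nonneg CFC.rpow_nonneg
  have hRSR : R * S * R = 1 := by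
    conv_lhs => rw [← CFC.rpow_one S hpos]
    rw [hR, ← CFC.rpow_add hunit, ← CFC.rpow_add hunit]
    norm_num [CFC.rpow_zero S hpos]
  refine ⟨R, hRsa, fun U hU f => ?_, fun f => ?_⟩
  · let V : H →L[ℂ] H := U.toContinuousLinearEquiv.toContinuousLinearMap
    have hcomm : Commute S V := by
      -- Over ℂ an operator is determined by its quadratic form, and `U` preserves that of S; hence
      -- V*SV = S.
      have h1 : ((adjoint V ∘L S ∘L V : H →L[ℂ] H) : H →ₗ[ℂ] H) = S := by
        rw [← ext_inner_map]
        intro f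
        change ⟪adjoint V (S (U f)), f⟫_ℂ = ⟪S f, f⟫_ℂ
        rw [adjoint_inner_left]
        change ⟪S (U f), U f⟫_ℂ = _
        rw [hSf, hSf, hU]
      ext f
      refine ext_inner_right ℂ fun w => ?_
      obtain ⟨v, rfl⟩ := U.surjective w
      have h2 := congrArg (fun T : H →ₗ[ℂ] H => ⟪T f, v⟫_ℂ) h1
      change ⟪adjoint V (S (U f)), v⟫_ℂ = ⟪S f, v⟫_ℂ at h2
      rw [adjoint_inner_left] at h2
      change ⟪S (U f), U v⟫_ℂ = ⟪U (S f), U v⟫_ℂ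
      rw [U.inner_map_map]
      exact h2
    have hRV : Commute R V := hcomm.cfc_nnreal _
    exact congrArg (fun T : H →L[ℂ] H => T f) hRV.eq
  · have h1 : ∑' i, ‖⟪e i, R f⟫_ℂ‖ ^ 2 = ‖f‖ ^ 2 := by
      have h2 : ⟪S (R f), R f⟫_ℂ = ⟪f, f⟫_ℂ := by
        rw [← adjoint_inner_left, hRsa.adjoint_eq]
        exact congrArg (fun T : H →L[ℂ] H => ⟪T f, f⟫_ℂ) hRSR
      rw [hSf, inner_self_eq_norm_sq_to_K] at h2
      exact Complex.ofReal_injective (by simpa using h2)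
    exact h1 ▸ (h (R f)).1.hasSum

end Frame

/-! ### Time-frequency shifts as a projective unitary representation -/

section TimeFreqShift

open scoped InnerProductSpace

variable {d n : ℕ}

theorem coeFn_timeFreqShift (z : Fin d ⊕ Fin d → ℝ) (f : L2Vec d n) :
    timeFreqShift z f =ᵐ[volume] timeFreqShiftFun (WithLp.toLp 2 fun i => z (Sum.inl i))
      (WithLp.toLp 2 fun i => z (Sum.inr i)) f :=
  MemLp.coeFn_toLp _

theorem ae_comp_sub_right {p : EuclideanSpace ℝ (Fin d) → Prop} (h : ∀ᵐ t, p t)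
    (x : EuclideanSpace ℝ (Fin d)) : ∀ᵐ t, p (t - x) :=
  (measurePreserving_sub_right volume x).quasiMeasurePreserving.ae h

theorem timeFreqShift_add (z : Fin d ⊕ Fin d → ℝ) (f g : L2Vec d n) :
    timeFreqShift z (f + g) = timeFreqShift z f + timeFreqShift z g := by
  refine Lp.ext ?_
  filter_upwards [coeFn_timeFreqShift z (f + g), coeFn_timeFreqShift z f, coeFn_timeFreqShift z g,
    Lp.coeFn_add (timeFreqShift z f) (timeFreqShift z g),
    ae_comp_sub_right (Lp.coeFn_add f g) (WithLp.toLp 2 fun i => z (Sum.inl i))]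
    with t h1 h2 h3 h4 h5
  rw [h1, h4, Pi.add_apply, h2, h3]
  simp only [timeFreqShiftFun]
  rw [h5, Pi.add_apply, smul_add]

theorem timeFreqShift_smul (z : Fin d ⊕ Fin d → ℝ) (c : ℂ) (f : L2Vec d n) :
    timeFreqShift z (c • f) = c • timeFreqShift z f := by
  refine Lp.ext ?_
  filter_upwards [coeFn_timeFreqShift z (c • f), coeFn_timeFreqShift z f,
    Lp.coeFn_smul c (timeFreqShift z f),
    ae_comp_sub_right (Lp.coeFn_smul c f) (WithLp.toLp 2 fun i => z (Sum.inl i))]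
    with t h1 h2 h3 h4
  rw [h1, h3, Pi.smul_apply, h2]
  simp only [timeFreqShiftFun]
  rw [h4, Pi.smul_apply, smul_comm]

theorem norm_exp_two_pi_I_mul (r : ℝ) :
    ‖Complex.exp (2 * Real.pi * Complex.I * (r : ℂ))‖ = 1 := by
  rw [show (2 * Real.pi * Complex.I * r : ℂ) = ((2 * Real.pi * r : ℝ) : ℂ) * Complex.I by
    push_cast; ring, Complex.norm_exp_ofReal_mul_I]

theorem norm_timeFreqShift (z : Fin d ⊕ Fin d → ℝ) (f : L2Vec d n) :
    ‖timeFreqShift z f‖ = ‖f‖ := by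
  set x : EuclideanSpace ℝ (Fin d) := WithLp.toLp 2 fun i => z (Sum.inl i) with hx
  rw [Lp.norm_def, Lp.norm_def, eLpNorm_congr_ae (coeFn_timeFreqShift z f),
    ← eLpNorm_comp_measurePreserving (Lp.aestronglyMeasurable f)
      (measurePreserving_sub_right volume x)]
  congr 1
  refine eLpNorm_congr_norm_ae (Filter.Eventually.of_forall fun t => ?_)
  simp only [timeFreqShiftFun, norm_smul, norm_exp_two_pi_I_mul, one_mul, Function.comp, hx]

/-- Translating by x the modulation of frequency η costs the constant phase exp(-2πi η·x). Only its
modulus matters later. -/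
theorem timeFreqShift_timeFreqShift (z w : Fin d ⊕ Fin d → ℝ) :
    ∃ c : ℂ, ‖c‖ = 1 ∧ ∀ f : L2Vec d n,
      timeFreqShift z (timeFreqShift w f) = c • timeFreqShift (z + w) f := by
  set x : EuclideanSpace ℝ (Fin d) := WithLp.toLp 2 fun i => z (Sum.inl i) with hx
  set ξ : EuclideanSpace ℝ (Fin d) := WithLp.toLp 2 fun i => z (Sum.inr i) with hξ
  set y : EuclideanSpace ℝ (Fin d) := WithLp.toLp 2 fun i => w (Sum.inl i) with hy
  set η : EuclideanSpace ℝ (Fin d) := WithLp.toLp 2 fun i => w (Sum.inr i) with hη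
  have hxy : (WithLp.toLp 2 fun i => (z + w) (Sum.inl i) : EuclideanSpace ℝ (Fin d)) = x + y := rfl
  have hξη : (WithLp.toLp 2 fun i => (z + w) (Sum.inr i) : EuclideanSpace ℝ (Fin d)) = ξ + η := rfl
  refine ⟨Complex.exp (2 * Real.pi * Complex.I * ((-⟪η, x⟫_ℝ : ℝ) : ℂ)),
    norm_exp_two_pi_I_mul _, fun f => Lp.ext ?_⟩
  filter_upwards [coeFn_timeFreqShift z (timeFreqShift w f), coeFn_timeFreqShift (z + w) f,
    Lp.coeFn_smul (Complex.exp (2 * Real.pi * Complex.I * ((-⟪η, x⟫_ℝ : ℝ) : ℂ)))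
      (timeFreqShift (z + w) f),
    ae_comp_sub_right (coeFn_timeFreqShift w f) x] with t h1 h2 h3 h4
  rw [h1, h3, Pi.smul_apply, h2, hxy, hξη]
  simp only [timeFreqShiftFun]
  rw [h4]
  simp only [timeFreqShiftFun]
  rw [smul_smul, smul_smul, ← Complex.exp_add, ← Complex.exp_add, sub_sub]
  congr 2
  rw [inner_sub_right, inner_add_left]
  push_cast
  ring

theorem timeFreqShift_zero (f : L2Vec d n) : timeFreqShift 0 f = f := by
  refine Lp.ext ?_
  filter_upwards [coeFn_timeFreqShift 0 f] with t ht
  have h0 : (WithLp.toLp 2 fun _ => (0 : ℝ) : EuclideanSpace ℝ (Fin d)) = 0 := rfl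
  rw [ht]
  simp [timeFreqShiftFun, h0]

/-- The time-frequency shift as a unitary operator. -/
def timeFreqShiftEquiv (z : Fin d ⊕ Fin d → ℝ) : L2Vec d n ≃ₗᵢ[ℂ] L2Vec d n :=
  LinearIsometryEquiv.ofSurjective
    { toFun := timeFreqShift z
      map_add' := timeFreqShift_add z
      map_smul' := timeFreqShift_smul z
      norm_map' := norm_timeFreqShift z } fun f => by
    obtain ⟨c, hc, h⟩ := timeFreqShift_timeFreqShift (n := n) z (-z)
    refine ⟨c⁻¹ • timeFreqShift (-z) f, ?_⟩
    change timeFreqShift z _ = _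
    rw [timeFreqShift_smul, h, add_neg_cancel, timeFreqShift_zero, smul_smul, inv_mul_cancel₀,
      one_smul]
    rintro rfl
    simp at hc

/-- The modulus of an inner product with `π_{z+w} g` can be computed by moving `π_z` across. -/
theorem norm_inner_timeFreqShift_add (z w : Fin d ⊕ Fin d → ℝ) (g f : L2Vec d n) :
    ‖⟪timeFreqShift (z + w) g, timeFreqShift z f⟫_ℂ‖ = ‖⟪timeFreqShift w g, f⟫_ℂ‖ := by
  obtain ⟨c, hc, h⟩ := timeFreqShift_timeFreqShift (n := n) z w
  have h1 : ⟪timeFreqShift z (timeFreqShift w g), timeFreqShift z f⟫_ℂ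
      = ⟪timeFreqShift w g, f⟫_ℂ := (timeFreqShiftEquiv z).inner_map_map _ _
  rw [← h1, h, inner_smul_left, norm_mul, RCLike.norm_conj, hc, one_mul]

/-- A Gabor frame over a subgroup has an associated Parseval Gabor frame. -/
theorem exists_parseval_window (L : AddSubgroup (Fin d ⊕ Fin d → ℝ)) (g : L2Vec d n)
    (hg : IsFrame (gaborSystem g (L : Set (Fin d ⊕ Fin d → ℝ)))) :
    ∃ γ : L2Vec d n, ∀ f, HasSum (fun l : L => ‖⟪timeFreqShift l γ, f⟫_ℂ‖ ^ 2) (‖f‖ ^ 2) := by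
  obtain ⟨R, hR, hcomm, hsum⟩ := hg.exists_parseval
  refine ⟨R g, fun f => ?_⟩
  suffices h : ∀ l : L, ⟪timeFreqShift l (R g), f⟫_ℂ = ⟪gaborSystem g (L : Set _) l, R f⟫_ℂ by
    simp_rw [h]
    exact hsum f
  intro l
  have h1 : R (timeFreqShift l g) = timeFreqShift l (R g) := by
    refine hcomm (timeFreqShiftEquiv l) (fun f => ?_) g
    -- Reindexing the lattice by m ↦ l + m shows that π_l leaves the sum of squared coefficients
    -- invariant.
    refine ((Equiv.addLeft l).tsum_eq
      fun m : L => ‖⟪timeFreqShift m g, timeFreqShift l f⟫_ℂ‖ ^ 2).symm.trans ?_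
    refine tsum_congr fun m => ?_
    exact congrArg (· ^ 2) (norm_inner_timeFreqShift_add (l : Fin d ⊕ Fin d → ℝ) m g f)
  rw [← h1]
  conv_lhs => rw [← hR.adjoint_eq]
  rw [ContinuousLinearMap.adjoint_inner_left]
  rfl

/-- The term l = 0 of the Parseval sum for f = γ is ‖γ‖⁴, and the whole sum is ‖γ‖². -/
theorem norm_parseval_window_le_one {L : AddSubgroup (Fin d ⊕ Fin d → ℝ)} {γ : L2Vec d n}
    (h : ∀ f, HasSum (fun l : L => ‖⟪timeFreqShift l γ, f⟫_ℂ‖ ^ 2) (‖f‖ ^ 2)) : ‖γ‖ ≤ 1 := by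
  have h1 := le_hasSum (h γ) (0 : L) fun l _ => by positivity
  rw [ZeroMemClass.coe_zero, timeFreqShift_zero, inner_self_eq_norm_sq_to_K] at h1
  have h2 : (‖γ‖ ^ 2) ^ 2 ≤ ‖γ‖ ^ 2 := by simpa using h1
  by_contra! h3
  nlinarith [sq_nonneg (‖γ‖ ^ 2), one_lt_pow₀ h3 two_ne_zero]

end TimeFreqShift

/-! ### Plancherel for the Fourier integral -/

section Plancherel

open scoped FourierTransform SchwartzMap ContDiff

variable {E : Type*} [NormedAddCommGroup E] [InnerProductSpace ℝ E] [FiniteDimensional ℝ E]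
  [MeasurableSpace E] [BorelSpace E]

/-- The `L²` Fourier transform agrees with the Fourier integral on `L¹ ∩ L²`. -/
theorem fourier_toLp_ae_eq {ψ : E → ℂ} (h1 : Integrable ψ) (h2 : MemLp ψ 2) :
    ∀ᵐ ξ, (𝓕 (h2.toLp ψ) : Lp ℂ 2 (volume : Measure E)) ξ = 𝓕 ψ ξ := by
  have hcont : Continuous (𝓕 ψ) :=
    VectorFourier.fourierIntegral_continuous Real.continuous_fourierChar
      (by exact continuous_inner) h1
  -- Both sides are tested against smooth compactly supported functions: the L² transform through
  -- tempered distributions, the integral through Fubini.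
  refine ae_eq_of_integral_contDiff_smul_eq
    ((Lp.memLp _).locallyIntegrable (by norm_num)) hcont.locallyIntegrable fun g hg hgc => ?_
  have hg' : ContDiff ℝ ∞ fun x => (g x : ℂ) := Complex.ofRealCLM.contDiff.comp hg
  have hgc' : HasCompactSupport fun x => (g x : ℂ) := hgc.comp_left Complex.ofReal_zero
  let G : 𝓢(E, ℂ) := hgc'.toSchwartzMap hg'
  have hG : ∀ x, G x = (g x : ℂ) := fun x => rfl
  have e1 := congrArg (fun T => T G) (Lp.fourier_toTemperedDistribution_eq (h2.toLp ψ))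
  simp only [TemperedDistribution.fourier_apply, Lp.toTemperedDistribution_apply] at e1
  have e2 : ∫ ξ, 𝓕 (G : E → ℂ) ξ • ψ ξ = ∫ x, G x • 𝓕 ψ x := by
    have := VectorFourier.integral_fourierIntegral_smul_eq_flip (μ := (volume : Measure E))
      (ν := (volume : Measure E)) (L := innerₗ E) Real.continuous_fourierChar
      (by exact continuous_inner) (G.integrable (μ := volume)) h1
    rw [flip_innerₗ] at this
    exact this
  have e3 : ∫ ξ, (𝓕 G) ξ • (h2.toLp ψ) ξ = ∫ ξ, 𝓕 (G : E → ℂ) ξ • ψ ξ := by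
    refine integral_congr_ae ?_
    filter_upwards [h2.coeFn_toLp] with x hx
    rw [hx, SchwartzMap.fourier_coe]
  rw [e3, e2] at e1
  simpa [hG] using e1.symm

/-- Plancherel's inequality for integrable functions. -/
theorem lintegral_enorm_fourier_sq_le {ψ : E → ℂ} (h1 : Integrable ψ) :
    ∫⁻ ξ, ‖𝓕 ψ ξ‖ₑ ^ 2 ≤ ∫⁻ t, ‖ψ t‖ₑ ^ 2 := by
  by_cases hfin : ∫⁻ t, ‖ψ t‖ₑ ^ 2 = ⊤
  · rw [hfin]; exact le_top
  have key : ∀ f : E → ℂ, eLpNorm f 2 volume ^ 2 = ∫⁻ t, ‖f t‖ₑ ^ 2 := fun f => by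
    have := eLpNorm_nnreal_pow_eq_lintegral (μ := (volume : Measure E)) (f := f)
      (p := 2) (by norm_num)
    simpa using this
  have h2 : MemLp ψ 2 := by
    refine ⟨h1.1, ?_⟩
    rw [← key] at hfin
    refine lt_top_iff_ne_top.2 fun h => hfin ?_
    simp [h]
  rw [← key ψ, ← key (𝓕 ψ), ← eLpNorm_congr_ae (fourier_toLp_ae_eq h1 h2),
    ← eLpNorm_congr_ae h2.coeFn_toLp, ← Lp.enorm_def, ← Lp.enorm_def]
  have := Lp.norm_fourier_eq (h2.toLp ψ)
  rw [← ofReal_norm, ← ofReal_norm, this]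

end Plancherel

/-! ### Moyal's inequality for the short-time Fourier transform -/

section Moyal

open scoped InnerProductSpace FourierTransform

variable {d n : ℕ}

theorem inner_timeFreqShift_eq_fourier (g f : L2Vec d n) (z : Fin d ⊕ Fin d → ℝ) :
    ⟪timeFreqShift z g, f⟫_ℂ = 𝓕 (fun t => ⟪g (t - WithLp.toLp 2 fun i => z (Sum.inl i)), f t⟫_ℂ)
      (WithLp.toLp 2 fun i => z (Sum.inr i)) := by
  rw [L2.inner_def, Real.fourier_eq']
  refine integral_congr_ae ?_
  filter_upwards [coeFn_timeFreqShift z g] with t ht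
  rw [ht, timeFreqShiftFun, inner_smul_left, ← Complex.exp_conj, smul_eq_mul, real_inner_comm]
  congr 2
  simp only [map_mul, Complex.conj_ofReal, Complex.conj_I, Complex.conj_ofNat]
  push_cast
  ring

theorem integrable_inner_comp_sub_right (g f : L2Vec d n) (x : EuclideanSpace ℝ (Fin d)) :
    Integrable fun t => ⟪g (t - x), f t⟫_ℂ := by
  have h1 : MemLp (fun t => g (t - x)) 2 volume :=
    (Lp.memLp g).comp_measurePreserving (measurePreserving_sub_right volume x)
  refine (L2.integrable_inner (𝕜 := ℂ) (h1.toLp _) f).congr ?_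
  filter_upwards [h1.coeFn_toLp] with t ht
  rw [ht]

theorem stronglyMeasurable_inner_comp_sub (g f : L2Vec d n) :
    StronglyMeasurable fun p : EuclideanSpace ℝ (Fin d) × EuclideanSpace ℝ (Fin d) =>
      ⟪g (p.2 - p.1), f p.2⟫_ℂ :=
  ((Lp.stronglyMeasurable g).comp_measurable (measurable_snd.sub measurable_fst)).inner
    ((Lp.stronglyMeasurable f).comp_measurable measurable_snd)

/-- Joint measurability in position and frequency is what Tonelli needs in Moyal's inequality. -/
theorem stronglyMeasurable_fourier_inner (g f : L2Vec d n) :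
    StronglyMeasurable fun p : EuclideanSpace ℝ (Fin d) × EuclideanSpace ℝ (Fin d) =>
      𝓕 (fun t => ⟪g (t - p.1), f t⟫_ℂ) p.2 := by
  have h1 : StronglyMeasurable fun
      q : (EuclideanSpace ℝ (Fin d) × EuclideanSpace ℝ (Fin d)) × EuclideanSpace ℝ (Fin d) =>
      Complex.exp (↑(-2 * Real.pi * ⟪q.2, q.1.2⟫_ℝ) * Complex.I) := by
    refine Continuous.stronglyMeasurable ?_
    fun_prop
  have h2 : StronglyMeasurable fun
      q : (EuclideanSpace ℝ (Fin d) × EuclideanSpace ℝ (Fin d)) × EuclideanSpace ℝ (Fin d) =>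
      ⟪g (q.2 - q.1.1), f q.2⟫_ℂ :=
    (stronglyMeasurable_inner_comp_sub g f).comp_measurable
      (g := fun q : (EuclideanSpace ℝ (Fin d) × EuclideanSpace ℝ (Fin d)) ×
        EuclideanSpace ℝ (Fin d) => (q.1.1, q.2))
      ((measurable_fst.comp measurable_fst).prodMk measurable_snd)
  have h3 := (h1.smul h2).integral_prod_right' (ν := volume)
  convert! h3 using 2 with p
  rw [Real.fourier_eq']
  rfl

/-- The splitting of `ℝ^{2d}` into positions and frequencies. -/
def phaseSpaceSplit (z : Fin d ⊕ Fin d → ℝ) :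
    EuclideanSpace ℝ (Fin d) × EuclideanSpace ℝ (Fin d) :=
  (WithLp.toLp 2 fun i => z (Sum.inl i), WithLp.toLp 2 fun i => z (Sum.inr i))

theorem measurePreserving_phaseSpaceSplit :
    MeasurePreserving (phaseSpaceSplit (d := d)) volume volume :=
  ((EuclideanSpace.volume_preserving_symm_measurableEquiv_toLp (Fin d)).symm.prod
    (EuclideanSpace.volume_preserving_symm_measurableEquiv_toLp (Fin d)).symm).comp
    (volume_measurePreserving_sumPiEquivProdPi fun _ : Fin d ⊕ Fin d => ℝ)

theorem measurable_inner_timeFreqShift (g f : L2Vec d n) :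
    Measurable fun z => ⟪timeFreqShift z g, f⟫_ℂ := by
  have h := (stronglyMeasurable_fourier_inner g f).measurable.comp
    (measurePreserving_phaseSpaceSplit (d := d)).measurable
  convert! h using 2 with z
  exact inner_timeFreqShift_eq_fourier g f z

/-- The inequality part of Moyal's identity. -/
theorem lintegral_enorm_inner_timeFreqShift_sq_le (g f : L2Vec d n) :
    ∫⁻ z, ‖⟪timeFreqShift z g, f⟫_ℂ‖ₑ ^ 2 ≤
      ∫⁻ t, ∫⁻ x, ‖⟪g (t - x), f t⟫_ℂ‖ₑ ^ 2 := by
  have hm := ((stronglyMeasurable_fourier_inner g f).measurable.enorm).pow_const 2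
  calc ∫⁻ z, ‖⟪timeFreqShift z g, f⟫_ℂ‖ₑ ^ 2
      = ∫⁻ p : EuclideanSpace ℝ (Fin d) × EuclideanSpace ℝ (Fin d),
          ‖𝓕 (fun t => ⟪g (t - p.1), f t⟫_ℂ) p.2‖ₑ ^ 2 := by
        rw [← (measurePreserving_phaseSpaceSplit (d := d)).lintegral_comp hm]
        refine lintegral_congr fun z => ?_
        rw [inner_timeFreqShift_eq_fourier]
        rfl
    _ = ∫⁻ x, ∫⁻ ξ, ‖𝓕 (fun t => ⟪g (t - x), f t⟫_ℂ) ξ‖ₑ ^ 2 :=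
        lintegral_prod _ hm.aemeasurable
    _ ≤ ∫⁻ x, ∫⁻ t, ‖⟪g (t - x), f t⟫_ℂ‖ₑ ^ 2 :=
        lintegral_mono fun x =>
          lintegral_enorm_fourier_sq_le (integrable_inner_comp_sub_right g f x)
    _ = _ := lintegral_lintegral_swap
        (((stronglyMeasurable_inner_comp_sub g f).measurable.enorm).pow_const 2).aemeasurable

end Moyal

/-! ### Unfolding over a fundamental domain and the density bound -/

section Density

open scoped InnerProductSpace

variable {d n : ℕ}

/-- Unfolding over a fundamental domain: a Parseval Gabor system has constant periodization. -/
theorem lintegral_enorm_inner_timeFreqShift_sq_eq (L : AddSubgroup (Fin d ⊕ Fin d → ℝ))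
    [Countable L] {D : Set (Fin d ⊕ Fin d → ℝ)} (hD : IsAddFundamentalDomain L D volume)
    {γ : L2Vec d n}
    (h : ∀ f, HasSum (fun l : L => ‖⟪timeFreqShift l γ, f⟫_ℂ‖ ^ 2) (‖f‖ ^ 2)) (f : L2Vec d n) :
    ∫⁻ z, ‖⟪timeFreqShift z γ, f⟫_ℂ‖ₑ ^ 2 = volume D * ‖f‖ₑ ^ 2 := by
  have hpt : ∀ z : Fin d ⊕ Fin d → ℝ,
      ∑' l : L, ‖⟪timeFreqShift (l +ᵥ z) γ, f⟫_ℂ‖ₑ ^ 2 = ‖f‖ₑ ^ 2 := fun z => by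
    -- With f = π_z w, the coefficients against π_{l+z} γ have the moduli of those of w against π_l
    -- γ, so Parseval applies to w.
    obtain ⟨w, rfl⟩ := (timeFreqShiftEquiv z).surjective f
    have h1 : ∀ l : L, ‖⟪timeFreqShift (l +ᵥ z) γ, timeFreqShiftEquiv z w⟫_ℂ‖ₑ ^ 2
        = ENNReal.ofReal (‖⟪timeFreqShift l γ, w⟫_ℂ‖ ^ 2) := fun l => by
      rw [← norm_inner_timeFreqShift_add z, ENNReal.ofReal_pow (norm_nonneg _), ofReal_norm,
        add_comm z]
      rfl
    rw [tsum_congr h1, ← ENNReal.ofReal_tsum_of_nonneg (fun l => by positivity) (h w).summable,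
      (h w).tsum_eq, ENNReal.ofReal_pow (norm_nonneg _), ofReal_norm,
      LinearIsometryEquiv.enorm_map]
  have hm : Measurable fun z => ‖⟪timeFreqShift z γ, f⟫_ℂ‖ₑ ^ 2 :=
    (measurable_inner_timeFreqShift γ f).enorm.pow_const 2
  have hm' : ∀ l : L, Measurable fun z => ‖⟪timeFreqShift (l +ᵥ z) γ, f⟫_ℂ‖ₑ ^ 2 := fun l =>
    hm.comp (measurable_const_vadd l)
  rw [hD.lintegral_eq_tsum'', ← lintegral_tsum fun l => (hm' l).aemeasurable]
  simp_rw [hpt]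
  rw [setLIntegral_const, mul_comm]

/-- The density bound for Parseval Gabor systems. -/
theorem volume_mul_card_le_one (L : AddSubgroup (Fin d ⊕ Fin d → ℝ))
    [Countable L] {D : Set (Fin d ⊕ Fin d → ℝ)} (hD : IsAddFundamentalDomain L D volume)
    {γ : L2Vec d n}
    (h : ∀ f, HasSum (fun l : L => ‖⟪timeFreqShift l γ, f⟫_ℂ‖ ^ 2) (‖f‖ ^ 2)) :
    n * volume D ≤ 1 := by
  set K : Set (EuclideanSpace ℝ (Fin d)) := Metric.ball 0 1 with hK
  have hKm : MeasurableSet K := Metric.isOpen_ball.measurableSet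
  have hK0 : volume K ≠ 0 := (Metric.measure_ball_pos volume _ one_pos).ne'
  have hKt : volume K ≠ ⊤ := measure_ball_lt_top.ne
  -- The test function 1_K e_j sees only the j-th coordinate of γ.
  let f : Fin n → L2Vec d n := fun j => indicatorConstLp 2 hKm hKt (EuclideanSpace.single j 1)
  have hf : ∀ j, ‖f j‖ₑ ^ 2 = volume K := fun j => by
    rw [← ofReal_norm, ← ENNReal.ofReal_pow (norm_nonneg _),
      norm_indicatorConstLp two_ne_zero ENNReal.ofNat_ne_top]
    simp only [PiLp.norm_single, norm_one, one_mul, ENNReal.toReal_ofNat]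
    rw [← Real.rpow_natCast, ← Real.rpow_mul measureReal_nonneg]
    norm_num
    exact ENNReal.ofReal_toReal hKt
  have hγ : ∑ j, ∫⁻ t, ‖γ t j‖ₑ ^ 2 = ‖γ‖ₑ ^ 2 := by
    have hmeas : ∀ j, Measurable fun t => ‖γ t j‖ₑ ^ 2 := fun j =>
      (((EuclideanSpace.proj j : _ →L[ℂ] ℂ).continuous.measurable).comp
        (Lp.stronglyMeasurable γ).measurable).enorm.pow_const 2
    have h1 : ‖γ‖ₑ ^ 2 = ∫⁻ t, ‖γ t‖ₑ ^ 2 := by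
      have := eLpNorm_nnreal_pow_eq_lintegral (μ := (volume : Measure (EuclideanSpace ℝ (Fin d))))
        (f := γ) (p := 2) (by norm_num)
      rw [Lp.enorm_def]
      simpa using this
    rw [h1, ← lintegral_finsetSum _ fun j _ => hmeas j]
    refine lintegral_congr fun t => ?_
    simp_rw [← ofReal_norm, ← ENNReal.ofReal_pow (norm_nonneg _), EuclideanSpace.norm_sq_eq]
    rw [ENNReal.ofReal_sum_of_nonneg fun j _ => by positivity]
  have hle : ∀ j, volume D * volume K ≤ volume K * ∫⁻ t, ‖γ t j‖ₑ ^ 2 := fun j => by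
    calc volume D * volume K = ∫⁻ z, ‖⟪timeFreqShift z γ, f j⟫_ℂ‖ₑ ^ 2 := by
          rw [lintegral_enorm_inner_timeFreqShift_sq_eq L hD h, hf]
      _ ≤ ∫⁻ t, ∫⁻ x, ‖⟪γ (t - x), f j t⟫_ℂ‖ₑ ^ 2 :=
          lintegral_enorm_inner_timeFreqShift_sq_le _ _
      _ = ∫⁻ t, K.indicator (fun _ => ∫⁻ x, ‖γ x j‖ₑ ^ 2) t := by
          refine lintegral_congr_ae ?_
          filter_upwards [indicatorConstLp_coeFn (p := 2) (hs := hKm) (hμs := hKt)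
            (c := (EuclideanSpace.single j 1 : EuclideanSpace ℂ (Fin n)))] with t ht
          simp only [f]
          rw [ht]
          by_cases hmem : t ∈ K
          · simp only [Set.indicator_of_mem hmem]
            -- Invariance under x ↦ t - x makes the inner integral independent of t ∈ K.
            rw [← lintegral_sub_left_eq_self (fun x => ‖γ x j‖ₑ ^ 2) t]
            refine lintegral_congr fun x => ?_
            rw [EuclideanSpace.inner_single_right, one_mul, RCLike.enorm_conj]
          · simp [Set.indicator_of_notMem hmem]
      _ = volume K * ∫⁻ t, ‖γ t j‖ₑ ^ 2 := by
          rw [lintegral_indicator hKm, setLIntegral_const, mul_comm]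
  have hsum : volume K * (n * volume D) ≤ volume K * 1 := by
    calc volume K * (n * volume D) = ∑ _j : Fin n, volume D * volume K := by
          rw [Finset.sum_const, Finset.card_univ, Fintype.card_fin, nsmul_eq_mul]
          ring
      _ ≤ ∑ j, volume K * ∫⁻ t, ‖γ t j‖ₑ ^ 2 := Finset.sum_le_sum fun j _ => hle j
      _ = volume K * ‖γ‖ₑ ^ 2 := by rw [← Finset.mul_sum, hγ]
      _ ≤ volume K * 1 := by
          gcongr
          rw [← ofReal_norm, ← ENNReal.ofReal_pow (norm_nonneg _), ENNReal.ofReal_le_one]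
          exact pow_le_one₀ (norm_nonneg _) (norm_parseval_window_le_one h)
  exact (ENNReal.mul_le_mul_iff_right hK0 hKt).1 hsum

open scoped Classical in
/-- The columns of a non-singular matrix form a basis. -/
theorem exists_basis_col {ι : Type*} [Fintype ι] [DecidableEq ι] (A : Matrix ι ι ℝ)
    (hA : A.det ≠ 0) : ∃ b : Module.Basis ι ℝ (ι → ℝ), ⇑b = A.col := by
  have hu : IsUnit A := (Matrix.isUnit_iff_isUnit_det A).2 hA.isUnit
  have hli : LinearIndependent ℝ A.col := Matrix.linearIndependent_cols_iff_isUnit.2 hu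
  exact ⟨basisOfPiSpaceOfLinearIndependent hli, coe_basisOfPiSpaceOfLinearIndependent hli⟩

theorem latticeOf_eq_span (A : Matrix (Fin d ⊕ Fin d) (Fin d ⊕ Fin d) ℝ) :
    latticeOf A = ((Submodule.span ℤ (Set.range A.col)).toAddSubgroup : Set _) := by
  ext v
  change (∃ k : Fin d ⊕ Fin d → ℤ, _) ↔ v ∈ Submodule.span ℤ (Set.range A.col)
  rw [Submodule.mem_span_range_iff_exists_fun]
  refine exists_congr fun k => ?_
  rw [show ∑ i, k i • A.col i = A.mulVec fun i => (k i : ℝ) by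
    rw [Matrix.mulVec_eq_sum]
    refine Finset.sum_congr rfl fun i _ => ?_
    ext j
    simp [Matrix.col, mul_comm]]

end Density

end

theorem proposition2p6 (d n : ℕ) (hn : 1 ≤ n)
    (A : Matrix (Fin d ⊕ Fin d) (Fin d ⊕ Fin d) ℝ) (hA : A.det ≠ 0)
    (g : L2Vec d n) (hg : IsFrame (gaborSystem g (latticeOf A))) :
    latticeVolume A ≤ 1 / (n : ℝ) := by
  obtain ⟨b, hb⟩ := exists_basis_col A hA
  rw [latticeOf_eq_span, ← hb] at hg
  obtain ⟨γ, hγ⟩ := exists_parseval_window _ g hg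
  have : Countable (Submodule.span ℤ (Set.range b)).toAddSubgroup :=
    inferInstanceAs (Countable (Submodule.span ℤ (Set.range b)))
  have h := volume_mul_card_le_one _ (ZSpan.isAddFundamentalDomain' b volume) hγ
  -- The basis vectors, which are the columns of `A`, are the rows of `Matrix.of b`; hence the
  -- transpose.
  have hdet : (Matrix.of b).det = A.det := by
    rw [hb, ← Matrix.det_transpose]
    rfl
  rw [ZSpan.volume_fundamentalDomain, hdet, ← ENNReal.ofReal_natCast,
    ← ENNReal.ofReal_mul (Nat.cast_nonneg n), ENNReal.ofReal_le_one] at h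
  rw [latticeVolume, le_div_iff₀ (by exact_mod_cast hn), mul_comm]
  exact h
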